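/- Let $(\mathcal X,\mathcal F,\mu)$ and $(\mathcal Y,\mathcal G,\nu)$ be arbitrary probability spaces, and let $\Gamma(\mu,\nu)$ be the set of probability measures on $\mathcal F\otimes\mathcal G$ with marginals $\mu$ and $\nu$. For $H\in\mathcal F\otimes\mathcal G$ put $$\alpha(H)=\inf_{P\in\Gamma(\mu,\nu)}P(H),\qquad \alpha^*(H)=\sup_{P\in\Gamma(\mu,\nu)}P(H),$$ $$\beta(H)=\sup\Bigl\{\int f\,d\mu+\int g\,d\nu:\ f(x)+g(y)\le 1_H(x,y)\ \text{for all }(x,y)\in\mathcal X\times\mathcal Y\Bigr\},$$ $$\beta^*(H)=\inf\Bigl\{\int f\,d\mu+\int g\,d\nu:\ f(x)+g(y)\ge 1_H(x,y)\ \text{for all }(x,y)\in\mathcal X\times\mathcal Y\Bigr\},$$ where $f:\mathcal X\to\mathbb R$ ranges over the $\mathcal F$-measurable $\mu$-integrable functions and $g:\mathcal Y\to\mathbb R$ over the $\mathcal G$-measurable $\nu$-integrable functions. Let $\mathcal R$ be the field of subsets of $\mathcal X\times\mathcal Y$ generated by the measurable rectangles $A\times B$, $A\in\mathcal F$, $B\in\mathcal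 G$. Then: 1. If $R_n\in\mathcal R$ for all $n\in\mathbb N$, $H=\bigcup_nR_n$ and $K=\bigcap_nR_n$, then $\alpha^*(H)=\beta^*(H)$ and $\alpha(K)=\beta(K)$. 2. If $H=\bigcup_n(A_n\times B_n)$ with $A_n\in\mathcal F$, $B_n\in\mathcal G$, and $\mu(\limsup_nA_n)=0$ or $\nu(\limsup_nB_n)=0$, where $\limsup_nA_n=\bigcap_n\bigcup_{j>n}A_j$ and $\limsup_nB_n=\bigcap_n\bigcup_{j>n}B_j$, then $\alpha(H)=\beta(H)$. 3. (Arveson's problem for countable unions of rectangles.) If $H=\bigcup_n(A_n\times B_n)$ with $A_n\in\mathcal F$, $B_n\in\mathcal G$, and $P(H)=0$ for all $P\in\Gamma(\mu,\nu)$, then there are $A\in\mathcal F$ and $B\in\mathcal G$ such that $\mu(A)=\nu(B)=0$ and $H\subset(A\times\mathcal Y)\cup(\mathcal X\times B)$. -/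

import Mathlib

open MeasureTheory

noncomputable section

namespace TransportDuality

variable {X Y : Type*} [MeasurableSpace X] [MeasurableSpace Y]

/-- `Γ(μ, ν)`: the probability measures on the product σ-field with marginals `μ` and `ν`. -/
def couplings (μ : Measure X) (ν : Measure Y) : Set (Measure (X × Y)) :=
  {P | IsProbabilityMeasure P ∧ P.fst = μ ∧ P.snd = ν}

/-- `L₁(Q)`: the measurable and `Q`-integrable real functions; functions that agree `Q`-almost
surely are not identified. -/
def LOne {Ω : Type*} [MeasurableSpace Ω] (Q : Measure Ω) : Set (Ω → ℝ) :=
  {φ | Measurable φ ∧ Integrable φ Q}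

/-- The class `M` of admissible cost functions: the measurable `c` with
`f₁ + g₁ ≤ c ≤ f₂ + g₂` for some `f₁, f₂ ∈ L₁(μ)` and `g₁, g₂ ∈ L₁(ν)`. -/
def admissibleCosts (μ : Measure X) (ν : Measure Y) : Set (X × Y → ℝ) :=
  {c | Measurable c ∧
    (∃ f₁ ∈ LOne μ, ∃ g₁ ∈ LOne ν, ∀ x y, f₁ x + g₁ y ≤ c (x, y)) ∧
    (∃ f₂ ∈ LOne μ, ∃ g₂ ∈ LOne ν, ∀ x y, c (x, y) ≤ f₂ x + g₂ y)}

/-- The values `P(c) = ∫ c dP`, for `P` in `Γ(μ, ν)`. -/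
def primalValues (μ : Measure X) (ν : Measure Y) (c : X × Y → ℝ) : Set ℝ :=
  {r | ∃ P ∈ couplings μ ν, r = ∫ z, c z ∂P}

/-- The values `μ(f) + ν(g)`, for `f ∈ L₁(μ)` and `g ∈ L₁(ν)` with `f + g ≤ c` everywhere. -/
def lowerDualValues (μ : Measure X) (ν : Measure Y) (c : X × Y → ℝ) : Set ℝ :=
  {r | ∃ f ∈ LOne μ, ∃ g ∈ LOne ν, (∀ x y, f x + g y ≤ c (x, y)) ∧
    r = ∫ x, f x ∂μ + ∫ y, g y ∂ν}

/-- The values `μ(f) + ν(g)`, for `f ∈ L₁(μ)` and `g ∈ L₁(ν)` with `f + g ≥ c` everywhere. -/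
def upperDualValues (μ : Measure X) (ν : Measure Y) (c : X × Y → ℝ) : Set ℝ :=
  {r | ∃ f ∈ LOne μ, ∃ g ∈ LOne ν, (∀ x y, c (x, y) ≤ f x + g y) ∧
    r = ∫ x, f x ∂μ + ∫ y, g y ∂ν}

/-- `α(c) = inf {P(c) : P ∈ Γ(μ, ν)}`. -/
def alpha (μ : Measure X) (ν : Measure Y) (c : X × Y → ℝ) : ℝ := sInf (primalValues μ ν c)

/-- `α*(c) = sup {P(c) : P ∈ Γ(μ, ν)}`. -/
def alphaStar (μ : Measure X) (ν : Measure Y) (c : X × Y → ℝ) : ℝ := sSup (primalValues μ ν c)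

/-- `β(c) = sup {μ(f) + ν(g) : f + g ≤ c}`. -/
def beta (μ : Measure X) (ν : Measure Y) (c : X × Y → ℝ) : ℝ := sSup (lowerDualValues μ ν c)

/-- `β*(c) = inf {μ(f) + ν(g) : f + g ≥ c}`. -/
def betaStar (μ : Measure X) (ν : Measure Y) (c : X × Y → ℝ) : ℝ := sInf (upperDualValues μ ν c)

/-- The indicator function `1_H` of a set `H`, as a cost function. -/
def ind (H : Set (X × Y)) : X × Y → ℝ := H.indicator (fun _ => 1)

/-- The field of subsets of `X × Y` generated by the measurable rectangles. -/
def rectangleField (X Y : Type*) [MeasurableSpace X] [MeasurableSpace Y] : Set (Set (X × Y)) :=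
  generateSetAlgebra {R | ∃ A : Set X, ∃ B : Set Y, MeasurableSet A ∧ MeasurableSet B ∧ R = A ×ˢ B}

/-! The facts below show that, for admissible costs, no infimum or supremum above is taken over an
empty or unbounded set of reals, and that indicators of measurable sets are admissible. -/

theorem couplings_nonempty (μ : Measure X) (ν : Measure Y) [IsProbabilityMeasure μ]
    [IsProbabilityMeasure ν] : (couplings μ ν).Nonempty :=
  ⟨μ.prod ν, inferInstance, by simp, by simp⟩

theorem integral_add_of_mem_couplings {μ : Measure X} {ν : Measure Y} {P : Measure (X × Y)}
    (hP : P ∈ couplings μ ν) {f : X → ℝ} {g : Y → ℝ} (hf : f ∈ LOne μ) (hg : g ∈ LOne ν) :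
    Integrable (fun z : X × Y => f z.1 + g z.2) P ∧
      ∫ z, (f z.1 + g z.2) ∂P = ∫ x, f x ∂μ + ∫ y, g y ∂ν := by
  obtain ⟨-, rfl, rfl⟩ := hP
  have h1 : Integrable (fun z : X × Y => f z.1) P := hf.2.comp_measurable measurable_fst
  have h2 : Integrable (fun z : X × Y => g z.2) P := hg.2.comp_measurable measurable_snd
  refine ⟨h1.add h2, ?_⟩
  rw [integral_add h1 h2, Measure.fst, Measure.snd,
    integral_map measurable_fst.aemeasurable hf.1.aestronglyMeasurable,
    integral_map measurable_snd.aemeasurable hg.1.aestronglyMeasurable]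

theorem integrable_of_mem_admissibleCosts {μ : Measure X} {ν : Measure Y} {P : Measure (X × Y)}
    (hP : P ∈ couplings μ ν) {c : X × Y → ℝ} (hc : c ∈ admissibleCosts μ ν) : Integrable c P := by
  obtain ⟨hm, ⟨f₁, hf₁, g₁, hg₁, h₁⟩, ⟨f₂, hf₂, g₂, hg₂, h₂⟩⟩ := hc
  have i₁ := (integral_add_of_mem_couplings hP hf₁ hg₁).1
  have i₂ := (integral_add_of_mem_couplings hP hf₂ hg₂).1
  refine (i₁.abs.add i₂.abs).mono' hm.aestronglyMeasurable (Filter.Eventually.of_forall ?_)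
  rintro ⟨x, y⟩
  have a := h₁ x y
  have b := h₂ x y
  simp only [Real.norm_eq_abs, Pi.add_apply]
  rw [abs_le]
  constructor
  · have := neg_abs_le (f₁ x + g₁ y)
    have := abs_nonneg (f₂ x + g₂ y)
    linarith
  · have := le_abs_self (f₂ x + g₂ y)
    have := abs_nonneg (f₁ x + g₁ y)
    linarith

/-- Weak duality, value by value. -/
theorem dualValues_le {μ : Measure X} {ν : Measure Y} {c : X × Y → ℝ}
    (hc : c ∈ admissibleCosts μ ν) {p : ℝ} (hp : p ∈ primalValues μ ν c) :
    (∀ r ∈ lowerDualValues μ ν c, r ≤ p) ∧ (∀ r ∈ upperDualValues μ ν c, p ≤ r) := by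
  obtain ⟨P, hP, rfl⟩ := hp
  have hi := integrable_of_mem_admissibleCosts hP hc
  constructor
  · rintro r ⟨f, hf, g, hg, h, rfl⟩
    rw [← (integral_add_of_mem_couplings hP hf hg).2]
    exact integral_mono (integral_add_of_mem_couplings hP hf hg).1 hi fun z => h z.1 z.2
  · rintro r ⟨f, hf, g, hg, h, rfl⟩
    rw [← (integral_add_of_mem_couplings hP hf hg).2]
    exact integral_mono hi (integral_add_of_mem_couplings hP hf hg).1 fun z => h z.1 z.2

theorem values_nonempty_bounded (μ : Measure X) (ν : Measure Y) [IsProbabilityMeasure μ]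
    [IsProbabilityMeasure ν] {c : X × Y → ℝ} (hc : c ∈ admissibleCosts μ ν) :
    (primalValues μ ν c).Nonempty ∧ BddBelow (primalValues μ ν c) ∧ BddAbove (primalValues μ ν c) ∧
      (lowerDualValues μ ν c).Nonempty ∧ BddAbove (lowerDualValues μ ν c) ∧
      (upperDualValues μ ν c).Nonempty ∧ BddBelow (upperDualValues μ ν c) := by
  obtain ⟨P, hP⟩ := couplings_nonempty μ ν
  have hp : ∫ z, c z ∂P ∈ primalValues μ ν c := ⟨P, hP, rfl⟩
  obtain ⟨r₁, h₁⟩ : (lowerDualValues μ ν c).Nonempty := by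
    obtain ⟨-, ⟨f, hf, g, hg, h⟩, -⟩ := hc
    exact ⟨_, f, hf, g, hg, h, rfl⟩
  obtain ⟨r₂, h₂⟩ : (upperDualValues μ ν c).Nonempty := by
    obtain ⟨-, -, ⟨f, hf, g, hg, h⟩⟩ := hc
    exact ⟨_, f, hf, g, hg, h, rfl⟩
  exact ⟨⟨_, hp⟩, ⟨r₁, fun p h => (dualValues_le hc h).1 _ h₁⟩,
    ⟨r₂, fun p h => (dualValues_le hc h).2 _ h₂⟩, ⟨r₁, h₁⟩,
    ⟨_, fun r h => (dualValues_le hc hp).1 r h⟩, ⟨r₂, h₂⟩,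
    ⟨_, fun r h => (dualValues_le hc hp).2 r h⟩⟩

theorem ind_mem_admissibleCosts (μ : Measure X) (ν : Measure Y) [IsProbabilityMeasure μ]
    [IsProbabilityMeasure ν] {H : Set (X × Y)} (hH : MeasurableSet H) :
    ind H ∈ admissibleCosts μ ν := by
  refine ⟨measurable_const.indicator hH,
    ⟨fun _ => 0, ⟨measurable_const, integrable_const _⟩, fun _ => 0,
      ⟨measurable_const, integrable_const _⟩, fun x y => ?_⟩,
    ⟨fun _ => 1, ⟨measurable_const, integrable_const _⟩, fun _ => 0,
      ⟨measurable_const, integrable_const _⟩, fun x y => ?_⟩⟩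
  · rw [add_zero]
    exact Set.indicator_nonneg (fun _ _ => zero_le_one) _
  · rw [add_zero]
    exact Set.indicator_le_self' (fun _ _ => zero_le_one) (x, y)

theorem measurableSet_of_mem_rectangleField {R : Set (X × Y)} (hR : R ∈ rectangleField X Y) :
    MeasurableSet R := by
  induction hR with
  | base s hs =>
    obtain ⟨A, B, hA, hB, rfl⟩ := hs
    exact hA.prod hB
  | empty => exact MeasurableSet.empty
  | compl s _ ih => exact ih.compl
  | union s t _ _ ihs iht => exact ihs.union iht

end TransportDuality

end

namespace TransportDuality

open Filter Topology

/-! No topology on the spaces is needed. A set of the field depends on finitely many cells of each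
factor, so its duality is a finite transportation problem, settled by separating a point from a
compact convex set (`exists_dual_pair_of_forall_plan_lt`). Plans lift to couplings as mixtures of
products of conditional measures, and dual pairs lift by composition.

Since `α*` is monotone, countable unions only require `β*` not to jump along increasing sets `H n`
(`betaStar_iUnion_le`). Near-optimal pairs `(f_j, g_j)` need not converge, but `(sup_{j ≥ k} f_j,
inf_{j ≥ k} g_j)` is still admissible for `H k`, and modularity of the dual value under max/min
shows that it costs little more than the supremum of the `β*(H n)`. These pairs are monotone in `k`,
and their limit is admissible for the union. Complements turn unions into intersections and `α*`,
`β*` into `α`, `β`.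

Under the limsup condition, finite unions exhaust `H` from inside with an error that is uniform over
the couplings, so duality passes to `H`. For Arveson's problem the product coupling alone suffices.
-/

/-! ### Finite duality by convex separation -/

/-- Finite transportation duality: a strict upper bound for the value of all transport plans
between two probability vectors is an upper bound for the value of some dual pair. -/
theorem exists_dual_pair_of_forall_plan_lt {ι κ : Type*} [Fintype ι] [Fintype κ]
    {p : ι → ℝ} {q : κ → ℝ} (hp : ∀ i, 0 ≤ p i) (hq : ∀ j, 0 ≤ q j)
    (hp1 : ∑ i, p i = 1) (hq1 : ∑ j, q j = 1) (c : ι → κ → ℝ) {a : ℝ}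
    (h : ∀ w : ι × κ → ℝ, (∀ z, 0 ≤ w z) → (∀ i, ∑ j, w (i, j) = p i) →
      (∀ j, ∑ i, w (i, j) = q j) → ∑ z, w z * c z.1 z.2 < a) :
    ∃ (f : ι → ℝ) (g : κ → ℝ), (∀ i j, c i j ≤ f i + g j) ∧
      ∑ i, p i * f i + ∑ j, q j * g j ≤ a := by
  classical
  let L : (ι × κ → ℝ) →ₗ[ℝ] (ι → ℝ) × (κ → ℝ) × ℝ :=
    { toFun := fun w => (fun i => ∑ j, w (i, j), fun j => ∑ i, w (i, j), ∑ z, w z * c z.1 z.2)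
      map_add' := fun v w => by
        ext <;> simp [Finset.sum_add_distrib, add_mul]
      map_smul' := fun r w => by
        ext <;> simp [Finset.mul_sum, mul_assoc] }
  have hLc : Continuous L := L.continuous_of_finiteDimensional
  have hconv : Convex ℝ (L '' stdSimplex ℝ (ι × κ)) := (convex_stdSimplex ℝ _).linear_image L
  have hclosed : IsClosed (L '' stdSimplex ℝ (ι × κ)) :=
    ((isCompact_stdSimplex ℝ (ι × κ)).image hLc).isClosed
  have hnot : ((p, q, a) : (ι → ℝ) × (κ → ℝ) × ℝ) ∉ L '' stdSimplex ℝ (ι × κ) := by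
    rintro ⟨w, hw, he⟩
    have h1 := congrArg Prod.fst he
    have h2 := congrArg (fun z => z.2.1) he
    have h3 := congrArg (fun z => z.2.2) he
    exact (h w hw.1 (fun i => congrFun h1 i) (fun j => congrFun h2 j)).ne h3
  obtain ⟨l, u, hlt, hu⟩ := geometric_hahn_banach_closed_point hconv hclosed hnot
  set f : ι → ℝ := fun i => l (Pi.single i 1, 0, 0) with hf
  set g : κ → ℝ := fun j => l (0, Pi.single j 1, 0) with hg
  set t : ℝ := l (0, 0, 1) with ht
  have hl : ∀ (x : ι → ℝ) (y : κ → ℝ) (s : ℝ),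
      l (x, y, s) = ∑ i, x i * f i + ∑ j, y j * g j + s * t := by
    intro x y s
    have hx : ((x, y, s) : (ι → ℝ) × (κ → ℝ) × ℝ) =
        ∑ i, x i • ((Pi.single i 1, 0, 0) : (ι → ℝ) × (κ → ℝ) × ℝ) +
        ∑ j, y j • ((0, Pi.single j 1, 0) : (ι → ℝ) × (κ → ℝ) × ℝ) +
        s • ((0, 0, 1) : (ι → ℝ) × (κ → ℝ) × ℝ) := by
      ext k <;> simp [Prod.fst_sum, Prod.snd_sum, Finset.sum_apply, Pi.single_apply]
    rw [hx]
    simp only [map_add, map_sum, map_smul, smul_eq_mul, hf, hg, ht]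
  have hLw : ∀ w ∈ stdSimplex ℝ (ι × κ),
      ∑ i, (∑ j, w (i, j)) * f i + ∑ j, (∑ i, w (i, j)) * g j +
        (∑ z, w z * c z.1 z.2) * t < u := by
    intro w hw
    have := hlt _ ⟨w, hw, rfl⟩
    rwa [show L w = (fun i => ∑ j, w (i, j), fun j => ∑ i, w (i, j), ∑ z, w z * c z.1 z.2)
      from rfl, hl] at this
  rw [hl] at hu
  -- The product plan has the right marginals and a value below `a`. Separation compares it with
  -- `(p, q, a)`, which differs only in the last coordinate, so the coefficient `t` is positive.
  have ht0 : 0 < t := by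
    have e1 : ∀ i, ∑ j, p i * q j = p i := fun i => by rw [← Finset.mul_sum, hq1, mul_one]
    have e2 : ∀ j, ∑ i, p i * q j = q j := fun j => by rw [← Finset.sum_mul, hp1, one_mul]
    have h1 := hLw (fun z => p z.1 * q z.2) ⟨fun z => mul_nonneg (hp _) (hq _), by
      rw [Fintype.sum_prod_type]; simp only [e1, hp1]⟩
    have h2 := h (fun z => p z.1 * q z.2) (fun z => mul_nonneg (hp _) (hq _)) e1 e2
    simp only [e1, e2] at h1
    by_contra hcon
    nlinarith
  -- The separating inequality at the vertices of the simplex, solved for `c i j`, gives the dual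
  -- pair below.
  have hfg : ∀ i j, f i + g j + c i j * t < u := by
    intro i j
    have := hLw (Pi.single (i, j) 1) (single_mem_stdSimplex ℝ (i, j))
    simpa [Pi.single_apply, Prod.ext_iff, Fintype.sum_prod_type, ite_and] using this
  refine ⟨fun i => (u - f i) / t, fun j => -g j / t, fun i j => ?_, ?_⟩
  · rw [← add_div, le_div_iff₀ ht0]
    linarith [hfg i j]
  · have : ∑ i, p i * ((u - f i) / t) + ∑ j, q j * (-g j / t) =
        (u - ∑ i, p i * f i - ∑ j, q j * g j) / t := by
      simp only [mul_div_assoc', ← Finset.sum_div, mul_sub, Finset.sum_sub_distrib,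
        ← Finset.sum_mul, hp1, mul_neg, Finset.sum_neg_distrib]
      ring
    rw [this, div_le_iff₀ ht0]
    linarith

/-! ### Indicators, max/min of pairs, tails of sets -/

theorem ind_le_one {X Y : Type*} (H : Set (X × Y)) (z : X × Y) : ind H z ≤ 1 :=
  Set.indicator_le_self' (fun _ _ => zero_le_one) z

theorem ind_nonneg {X Y : Type*} (H : Set (X × Y)) (z : X × Y) : 0 ≤ ind H z :=
  Set.indicator_nonneg (fun _ _ => zero_le_one) z

theorem ind_mono {X Y : Type*} {H K : Set (X × Y)} (h : H ⊆ K) (z : X × Y) : ind H z ≤ ind K z :=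
  Set.indicator_le_indicator_of_subset h (fun _ => zero_le_one) z

/-- The pair `(max f₁ f₂, min g₁ g₂)`. -/
def supInf {X Y : Type*} (p q : (X → ℝ) × (Y → ℝ)) : (X → ℝ) × (Y → ℝ) := (p.1 ⊔ q.1, p.2 ⊓ q.2)

/-- The pair `(min f₁ f₂, max g₁ g₂)`. -/
def infSup {X Y : Type*} (p q : (X → ℝ) × (Y → ℝ)) : (X → ℝ) × (Y → ℝ) := (p.1 ⊓ q.1, p.2 ⊔ q.2)

/-- `supInfFrom p d k` is `(max f_j, min g_j)` over `k ≤ j ≤ k + d`, where `p j = (f_j, g_j)`. -/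
def supInfFrom {X Y : Type*} (p : ℕ → (X → ℝ) × (Y → ℝ)) : ℕ → ℕ → (X → ℝ) × (Y → ℝ)
  | 0, k => p k
  | d + 1, k => supInf (p k) (supInfFrom p d (k + 1))

theorem supInfFrom_le_succ {X Y : Type*} (p : ℕ → (X → ℝ) × (Y → ℝ)) (d k : ℕ) :
    (supInfFrom p d k).1 ≤ (supInfFrom p (d + 1) k).1 ∧
      (supInfFrom p (d + 1) k).2 ≤ (supInfFrom p d k).2 := by
  induction d generalizing k with
  | zero => exact ⟨le_sup_left, inf_le_left⟩
  | succ d ih =>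
    exact ⟨sup_le_sup_left (ih (k + 1)).1 _, inf_le_inf_left _ (ih (k + 1)).2⟩

theorem tendsto_measureReal_iUnion_gt {X : Type*} [MeasurableSpace X] (μ : Measure X)
    [IsFiniteMeasure μ] {A : ℕ → Set X} (hA : ∀ n, MeasurableSet (A n))
    (h : μ (⋂ n, ⋃ j > n, A j) = 0) :
    Tendsto (fun n => μ.real (⋃ j > n, A j)) atTop (𝓝 0) := by
  have hanti : Antitone fun n => ⋃ j > n, A j := fun m n hmn =>
    Set.biUnion_subset_biUnion_left fun j hj => lt_of_le_of_lt hmn hj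
  have := tendsto_measure_iInter_atTop (μ := μ)
    (fun n => (MeasurableSet.biUnion (Set.to_countable {j | j > n})
      fun j _ => hA j).nullMeasurableSet) hanti ⟨0, measure_ne_top _ _⟩
  change Tendsto _ _ (𝓝 (μ (⋂ n, ⋃ j > n, A j))) at this
  rw [h] at this
  exact (ENNReal.tendsto_toReal ENNReal.zero_ne_top).comp this

variable {X Y : Type*} [MeasurableSpace X] [MeasurableSpace Y]

/-! ### Duality on the field, by reduction to finite spaces -/

/-- A set of the field generated by the rectangles is the preimage of a set in a finite product. -/
theorem exists_finite_factor_of_mem_rectangleField {R : Set (X × Y)}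
    (hR : R ∈ rectangleField X Y) :
    ∃ (ι κ : Type) (_ : Fintype ι) (_ : Fintype κ) (φ : X → ι) (ψ : Y → κ) (S : Set (ι × κ)),
      (∀ i, MeasurableSet (φ ⁻¹' {i})) ∧ (∀ j, MeasurableSet (ψ ⁻¹' {j})) ∧
      R = Prod.map φ ψ ⁻¹' S := by
  classical
  induction hR with
  | base s hs =>
    obtain ⟨A, B, hA, hB, rfl⟩ := hs
    -- `Prop` serves as the two-point space: a set is its own map to it.
    refine ⟨Prop, Prop, inferInstance, inferInstance, A, B, {z | z.1 ∧ z.2}, fun i => ?_,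
      fun j => ?_, rfl⟩
    · exact (measurable_mem.2 hA) (MeasurableSpace.measurableSet_top)
    · exact (measurable_mem.2 hB) (MeasurableSpace.measurableSet_top)
  | empty =>
    exact ⟨Unit, Unit, inferInstance, inferInstance, fun _ => (), fun _ => (), ∅,
      fun i => MeasurableSet.const _, fun j => MeasurableSet.const _, rfl⟩
  | compl s _ ih =>
    obtain ⟨ι, κ, h1, h2, φ, ψ, S, hφ, hψ, rfl⟩ := ih
    exact ⟨ι, κ, h1, h2, φ, ψ, Sᶜ, hφ, hψ, rfl⟩
  | union s t _ _ ihs iht =>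
    obtain ⟨ι, κ, h1, h2, φ, ψ, S, hφ, hψ, rfl⟩ := ihs
    obtain ⟨ι', κ', h1', h2', φ', ψ', S', hφ', hψ', rfl⟩ := iht
    refine ⟨ι × ι', κ × κ', inferInstance, inferInstance, fun x => (φ x, φ' x),
      fun y => (ψ y, ψ' y), {z | (z.1.1, z.2.1) ∈ S ∨ (z.1.2, z.2.2) ∈ S'}, ?_, ?_, rfl⟩
    · rintro ⟨i, i'⟩
      convert (hφ i).inter (hφ' i') using 1
      ext x; simp
    · rintro ⟨j, j'⟩
      convert (hψ j).inter (hψ' j') using 1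
      ext y; simp

/-- The integral of a function that factors through a finite type. -/
theorem integral_comp_of_fintype {ι : Type*} [Fintype ι] (μ : Measure X) [IsFiniteMeasure μ]
    {φ : X → ι} (hφ : ∀ i, MeasurableSet (φ ⁻¹' {i})) (f : ι → ℝ) :
    f ∘ φ ∈ LOne μ ∧ ∫ x, f (φ x) ∂μ = ∑ i, μ.real (φ ⁻¹' {i}) * f i := by
  let _ : MeasurableSpace ι := ⊤
  have hm : Measurable φ := measurable_to_countable' hφ
  have hf : Measurable f := measurable_from_top
  refine ⟨⟨hf.comp hm, ?_⟩, ?_⟩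
  · exact (Integrable.of_finite (μ := μ.map φ) (f := f)).comp_measurable hm
  · rw [← integral_map hm.aemeasurable hf.aestronglyMeasurable,
      integral_fintype Integrable.of_finite]
    simp [map_measureReal_apply hm]

/-- A finite measure is the mixture of its conditionings on the fibres of a map to a finite type. -/
theorem sum_measureReal_smul_cond {ι : Type*} [Fintype ι] (μ : Measure X) [IsFiniteMeasure μ]
    {φ : X → ι} (hφ : ∀ i, MeasurableSet (φ ⁻¹' {i})) :
    ∑ i, ENNReal.ofReal (μ.real (φ ⁻¹' {i})) • ProbabilityTheory.cond μ (φ ⁻¹' {i}) = μ := by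
  ext s hs
  simp only [Measure.finsetSum_apply, Measure.smul_apply, smul_eq_mul, measureReal_def,
    ENNReal.ofReal_toReal (measure_ne_top _ _)]
  calc ∑ i, μ (φ ⁻¹' {i}) * ProbabilityTheory.cond μ (φ ⁻¹' {i}) s
      = ∑ i, μ (s ∩ φ ⁻¹' {i}) := by
        refine Finset.sum_congr rfl fun i _ => ?_
        rw [mul_comm, ProbabilityTheory.cond_mul_eq_inter (hφ i), Set.inter_comm]
    _ = μ s := by
        rw [← tsum_fintype (L := .unconditional ι), ← measure_iUnion]
        · congr 1; ext x; simp
        · intro i j hij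
          exact Set.disjoint_left.2 fun x hx hx' => hij (hx.2.symm.trans hx'.2)
        · exact fun i => hs.inter (hφ i)

/-- A transport plan between the finite images of `μ` and `ν` lifts to a coupling. -/
theorem exists_coupling_of_plan {ι κ : Type*} [Fintype ι] [Fintype κ] (μ : Measure X)
    (ν : Measure Y) [IsProbabilityMeasure μ] [IsProbabilityMeasure ν]
    {φ : X → ι} {ψ : Y → κ} (hφ : ∀ i, MeasurableSet (φ ⁻¹' {i}))
    (hψ : ∀ j, MeasurableSet (ψ ⁻¹' {j})) {w : ι × κ → ℝ} (hw : ∀ z, 0 ≤ w z)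
    (hw1 : ∀ i, ∑ j, w (i, j) = μ.real (φ ⁻¹' {i}))
    (hw2 : ∀ j, ∑ i, w (i, j) = ν.real (ψ ⁻¹' {j})) :
    ∃ P ∈ couplings μ ν, ∀ c : ι × κ → ℝ,
      ∫ z, c (φ z.1, ψ z.2) ∂P = ∑ z, w z * c z := by
  classical
  set M : ι → Measure X := fun i => ProbabilityTheory.cond μ (φ ⁻¹' {i}) with hM
  set N : κ → Measure Y := fun j => ProbabilityTheory.cond ν (ψ ⁻¹' {j}) with hN
  -- Conditioning on a null cell gives the zero measure, not a probability; such cells carry no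
  -- weight in the plan.
  have hμ0 : ∀ i j, w (i, j) ≠ 0 → μ (φ ⁻¹' {i}) ≠ 0 := by
    intro i j hij h0
    have : ∑ j, w (i, j) = 0 := by rw [hw1, measureReal_def, h0]; rfl
    exact hij ((Finset.sum_eq_zero_iff_of_nonneg fun j _ => hw (i, j)).1 this j (Finset.mem_univ _))
  have hν0 : ∀ i j, w (i, j) ≠ 0 → ν (ψ ⁻¹' {j}) ≠ 0 := by
    intro i j hij h0
    have : ∑ i, w (i, j) = 0 := by rw [hw2, measureReal_def, h0]; rfl
    exact hij ((Finset.sum_eq_zero_iff_of_nonneg fun i _ => hw (i, j)).1 this i (Finset.mem_univ _))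
  have hMp : ∀ i j, w (i, j) ≠ 0 → IsProbabilityMeasure (M i) := fun i j h =>
    ProbabilityTheory.cond_isProbabilityMeasure (hμ0 i j h)
  have hNp : ∀ i j, w (i, j) ≠ 0 → IsProbabilityMeasure (N j) := fun i j h =>
    ProbabilityTheory.cond_isProbabilityMeasure (hν0 i j h)
  have hsum1 := sum_measureReal_smul_cond μ hφ
  have hsum2 := sum_measureReal_smul_cond ν hψ
  set P : Measure (X × Y) := ∑ z : ι × κ, ENNReal.ofReal (w z) • (M z.1).prod (N z.2) with hP
  have hfst : P.fst = μ := by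
    rw [hP, Measure.fst, Measure.map_finset_sum measurable_fst.aemeasurable,
      Fintype.sum_prod_type]
    conv_rhs => rw [← hsum1]
    refine Finset.sum_congr rfl fun i _ => ?_
    rw [← hw1, ENNReal.ofReal_sum_of_nonneg fun j _ => hw _, Finset.sum_smul]
    refine Finset.sum_congr rfl fun j _ => ?_
    by_cases h0 : w (i, j) = 0
    · simp [h0]
    · have := hNp i j h0
      rw [Measure.map_smul, Measure.map_fst_prod, measure_univ, one_smul]
  have hsnd : P.snd = ν := by
    rw [hP, Measure.snd, Measure.map_finset_sum measurable_snd.aemeasurable,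
      Fintype.sum_prod_type_right]
    conv_rhs => rw [← hsum2]
    refine Finset.sum_congr rfl fun j _ => ?_
    rw [← hw2, ENNReal.ofReal_sum_of_nonneg fun j _ => hw _, Finset.sum_smul]
    refine Finset.sum_congr rfl fun i _ => ?_
    by_cases h0 : w (i, j) = 0
    · simp [h0]
    · have := hMp i j h0
      rw [Measure.map_smul, Measure.map_snd_prod, measure_univ, one_smul]
  have hPp : IsProbabilityMeasure P := by
    constructor
    rw [← Measure.fst_univ, hfst, measure_univ]
  refine ⟨P, ⟨hPp, hfst, hsnd⟩, fun c => ?_⟩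
  have hconst : ∀ z : ι × κ, ∀ᵐ x ∂((M z.1).prod (N z.2)), c (φ x.1, ψ x.2) = c z := by
    intro z
    have h1 : ∀ᵐ x ∂((M z.1).prod (N z.2)), φ x.1 = z.1 :=
      Measure.quasiMeasurePreserving_fst.ae (ProbabilityTheory.ae_cond_mem (hφ z.1))
    have h2 : ∀ᵐ x ∂((M z.1).prod (N z.2)), ψ x.2 = z.2 :=
      Measure.quasiMeasurePreserving_snd.ae (ProbabilityTheory.ae_cond_mem (hψ z.2))
    filter_upwards [h1, h2] with x hx1 hx2
    rw [hx1, hx2]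
  rw [hP, integral_finsetSum_measure]
  · refine Finset.sum_congr rfl fun z _ => ?_
    rw [integral_smul_measure, integral_congr_ae (hconst z), ENNReal.toReal_ofReal (hw z)]
    by_cases h0 : w z = 0
    · simp [h0]
    · have := hMp z.1 z.2 h0
      have := hNp z.1 z.2 h0
      simp
  · intro z _
    refine Integrable.smul_measure ?_ ENNReal.ofReal_ne_top
    exact (integrable_congr (hconst z)).2 (integrable_const _)

/-- Duality for the sets of the field generated by the rectangles. -/
theorem alphaStar_eq_betaStar_of_mem_rectangleField (μ : Measure X) (ν : Measure Y)
    [IsProbabilityMeasure μ] [IsProbabilityMeasure ν] {R : Set (X × Y)}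
    (hR : R ∈ rectangleField X Y) : alphaStar μ ν (ind R) = betaStar μ ν (ind R) := by
  classical
  have hc := ind_mem_admissibleCosts μ ν (measurableSet_of_mem_rectangleField hR)
  obtain ⟨hne, -, hba, -, -, hne', hbb⟩ := values_nonempty_bounded μ ν hc
  refine le_antisymm (csSup_le hne fun p hp => le_csInf hne' (dualValues_le hc hp).2) ?_
  -- Separation needs a level `a` strictly above all plan values, hence strictly above `α*`.
  refine le_of_forall_gt_imp_ge_of_dense fun a ha => ?_
  obtain ⟨ι, κ, _, _, φ, ψ, S, hφ, hψ, rfl⟩ := exists_finite_factor_of_mem_rectangleField hR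
  have hμ1 := (integral_comp_of_fintype μ hφ fun _ => 1).2
  have hν1 := (integral_comp_of_fintype ν hψ fun _ => 1).2
  simp only [integral_const, probReal_univ, smul_eq_mul, mul_one] at hμ1 hν1
  obtain ⟨f, g, hfg, hle⟩ := exists_dual_pair_of_forall_plan_lt
    (fun i => measureReal_nonneg (μ := μ) (s := φ ⁻¹' {i}))
    (fun j => measureReal_nonneg (μ := ν) (s := ψ ⁻¹' {j})) hμ1.symm hν1.symm
    (fun i j => S.indicator (fun _ => 1) (i, j)) (a := a) (by
      intro w hw hw1 hw2
      obtain ⟨P, hP, hPc⟩ := exists_coupling_of_plan μ ν hφ hψ hw hw1 hw2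
      rw [← hPc (S.indicator fun _ => 1)]
      exact (le_csSup hba ⟨P, hP, rfl⟩).trans_lt ha)
  obtain ⟨hf, hf'⟩ := integral_comp_of_fintype μ hφ f
  obtain ⟨hg, hg'⟩ := integral_comp_of_fintype ν hψ g
  exact (csInf_le hbb ⟨_, hf, _, hg, fun x y => hfg (φ x) (ψ y), rfl⟩).trans
    (by simpa only [Function.comp_apply, hf', hg'] using hle)

/-! ### Dual pairs with values in the unit interval -/

/-- The measurable pairs of `[0, 1]`-valued functions with `1_H ≤ f + g`. -/
def unitDualPairs (H : Set (X × Y)) : Set ((X → ℝ) × (Y → ℝ)) :=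
  {p | Measurable p.1 ∧ Measurable p.2 ∧ (∀ x, p.1 x ∈ Set.Icc (0 : ℝ) 1) ∧
    (∀ y, p.2 y ∈ Set.Icc (0 : ℝ) 1) ∧ ∀ x y, ind H (x, y) ≤ p.1 x + p.2 y}

/-- The dual value `μ(f) + ν(g)` of a pair. -/
noncomputable def dualValue (μ : Measure X) (ν : Measure Y) (p : (X → ℝ) × (Y → ℝ)) : ℝ :=
  ∫ x, p.1 x ∂μ + ∫ y, p.2 y ∂ν

theorem unitDualPairs_anti {H K : Set (X × Y)} (h : H ⊆ K) :
    unitDualPairs K ⊆ unitDualPairs H := fun _ hp =>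
  ⟨hp.1, hp.2.1, hp.2.2.1, hp.2.2.2.1, fun x y => (ind_mono h _).trans (hp.2.2.2.2 x y)⟩

/-- At each `y` the minimum of the second components is attained by one of the pairs, and the
maximum of the first components dominates that pair's own. -/
theorem supInf_mem_unitDualPairs {H : Set (X × Y)} {p q : (X → ℝ) × (Y → ℝ)}
    (hp : p ∈ unitDualPairs H) (hq : q ∈ unitDualPairs H) : supInf p q ∈ unitDualPairs H := by
  obtain ⟨p1, p2, p3, p4, p5⟩ := hp
  obtain ⟨q1, q2, q3, q4, q5⟩ := hq
  refine ⟨p1.sup q1, p2.inf q2, fun x => ⟨le_sup_of_le_left (p3 x).1, sup_le (p3 x).2 (q3 x).2⟩,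
    fun y => ⟨le_inf (p4 y).1 (q4 y).1, inf_le_of_left_le (p4 y).2⟩, fun x y => ?_⟩
  simp only [supInf, Pi.sup_apply, Pi.inf_apply]
  rcases le_total (p.2 y) (q.2 y) with h | h
  · rw [inf_eq_left.2 h]
    exact (p5 x y).trans (by gcongr; exact le_sup_left)
  · rw [inf_eq_right.2 h]
    exact (q5 x y).trans (by gcongr; exact le_sup_right)

theorem infSup_mem_unitDualPairs {H : Set (X × Y)} {p q : (X → ℝ) × (Y → ℝ)}
    (hp : p ∈ unitDualPairs H) (hq : q ∈ unitDualPairs H) : infSup p q ∈ unitDualPairs H := by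
  obtain ⟨p1, p2, p3, p4, p5⟩ := hp
  obtain ⟨q1, q2, q3, q4, q5⟩ := hq
  refine ⟨p1.inf q1, p2.sup q2, fun x => ⟨le_inf (p3 x).1 (q3 x).1, inf_le_of_left_le (p3 x).2⟩,
    fun y => ⟨le_sup_of_le_left (p4 y).1, sup_le (p4 y).2 (q4 y).2⟩, fun x y => ?_⟩
  simp only [infSup, Pi.sup_apply, Pi.inf_apply]
  rcases le_total (p.1 x) (q.1 x) with h | h
  · rw [inf_eq_left.2 h]
    exact (p5 x y).trans (by gcongr; exact le_sup_left)
  · rw [inf_eq_right.2 h]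
    exact (q5 x y).trans (by gcongr; exact le_sup_right)

theorem integrable_of_mem_Icc {μ : Measure X} [IsFiniteMeasure μ] {f : X → ℝ} (hf : Measurable f)
    (h : ∀ x, f x ∈ Set.Icc (0 : ℝ) 1) : Integrable f μ :=
  Integrable.of_mem_Icc 0 1 hf.aemeasurable (Eventually.of_forall h)

/-- A countable union of rectangles that is null for the product measure is covered by the two
strips over null sets. -/
theorem exists_null_strips_of_prod_eq_zero (μ : Measure X) (ν : Measure Y)
    [SFinite ν] {A : ℕ → Set X} {B : ℕ → Set Y}
    (hA : ∀ n, MeasurableSet (A n)) (hB : ∀ n, MeasurableSet (B n))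
    (h : (μ.prod ν) (⋃ n, A n ×ˢ B n) = 0) :
    ∃ (A₀ : Set X) (B₀ : Set Y), MeasurableSet A₀ ∧ MeasurableSet B₀ ∧ μ A₀ = 0 ∧ ν B₀ = 0 ∧
      (⋃ n, A n ×ˢ B n) ⊆ (A₀ ×ˢ Set.univ) ∪ (Set.univ ×ˢ B₀) := by
  -- Each rectangle is null, so one of its sides is; the null sides on each factor are collected
  -- into one null set.
  have h0 : ∀ n, μ (A n) = 0 ∨ ν (B n) = 0 := fun n => by
    have := measure_mono_null (Set.subset_iUnion (fun n => A n ×ˢ B n) n) h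
    rwa [Measure.prod_prod, mul_eq_zero] at this
  refine ⟨⋃ n ∈ {n | μ (A n) = 0}, A n, ⋃ n ∈ {n | ν (B n) = 0}, B n,
    MeasurableSet.biUnion (Set.to_countable _) fun n _ => hA n,
    MeasurableSet.biUnion (Set.to_countable _) fun n _ => hB n,
    (measure_biUnion_null_iff (Set.to_countable _)).2 fun n hn => hn,
    (measure_biUnion_null_iff (Set.to_countable _)).2 fun n hn => hn, ?_⟩
  refine Set.iUnion_subset fun n z hz => ?_
  rcases h0 n with hn | hn
  · exact .inl ⟨Set.mem_biUnion hn hz.1, trivial⟩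
  · exact .inr ⟨trivial, Set.mem_biUnion hn hz.2⟩

variable (μ : Measure X) (ν : Measure Y) [IsProbabilityMeasure μ] [IsProbabilityMeasure ν]

/-- Modularity, from `max + min = sum` pointwise: a lower bound for one of the two combined pairs
becomes an upper bound for the other. -/
theorem dualValue_supInf_add_infSup {H K : Set (X × Y)} {p q : (X → ℝ) × (Y → ℝ)}
    (hp : p ∈ unitDualPairs H) (hq : q ∈ unitDualPairs K) :
    dualValue μ ν (supInf p q) + dualValue μ ν (infSup p q) =
      dualValue μ ν p + dualValue μ ν q := by
  have ip1 := integrable_of_mem_Icc (μ := μ) hp.1 hp.2.2.1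
  have iq1 := integrable_of_mem_Icc (μ := μ) hq.1 hq.2.2.1
  have ip2 := integrable_of_mem_Icc (μ := ν) hp.2.1 hp.2.2.2.1
  have iq2 := integrable_of_mem_Icc (μ := ν) hq.2.1 hq.2.2.2.1
  have h1 : ∫ x, (p.1 ⊔ q.1) x ∂μ + ∫ x, (p.1 ⊓ q.1) x ∂μ = ∫ x, p.1 x ∂μ + ∫ x, q.1 x ∂μ := by
    rw [← integral_add (ip1.sup iq1) (ip1.inf iq1), ← integral_add ip1 iq1]
    simp only [Pi.sup_apply, Pi.inf_apply, max_add_min]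
  have h2 : ∫ y, (p.2 ⊔ q.2) y ∂ν + ∫ y, (p.2 ⊓ q.2) y ∂ν = ∫ y, p.2 y ∂ν + ∫ y, q.2 y ∂ν := by
    rw [← integral_add (ip2.sup iq2) (ip2.inf iq2), ← integral_add ip2 iq2]
    simp only [Pi.sup_apply, Pi.inf_apply, max_add_min]
  simp only [dualValue, supInf, infSup]
  linarith

theorem betaStar_le_dualValue {H : Set (X × Y)} (hH : MeasurableSet H) {p : (X → ℝ) × (Y → ℝ)}
    (hp : p ∈ unitDualPairs H) : betaStar μ ν (ind H) ≤ dualValue μ ν p :=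
  csInf_le (values_nonempty_bounded μ ν (ind_mem_admissibleCosts μ ν hH)).2.2.2.2.2.2
    ⟨p.1, ⟨hp.1, integrable_of_mem_Icc hp.1 hp.2.2.1⟩, p.2,
      ⟨hp.2.1, integrable_of_mem_Icc hp.2.1 hp.2.2.2.1⟩, hp.2.2.2.2, rfl⟩

/-- For indicators, the dual pairs may be taken with values in `[0, 1]`. -/
theorem exists_unitDualPair_le {H : Set (X × Y)} {r : ℝ}
    (hr : r ∈ upperDualValues μ ν (ind H)) : ∃ p ∈ unitDualPairs H, dualValue μ ν p ≤ r := by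
  obtain ⟨f, hf, g, hg, hfg, rfl⟩ := hr
  have : Nonempty X := nonempty_of_isProbabilityMeasure μ
  have : Nonempty Y := nonempty_of_isProbabilityMeasure ν
  have h0 : ∀ x y, -g y ≤ f x := fun x y => by
    linarith [hfg x y, ind_nonneg H (x, y)]
  obtain ⟨y₀⟩ := ‹Nonempty Y›
  have hbdd : BddBelow (Set.range f) := ⟨-g y₀, by rintro _ ⟨x, rfl⟩; exact h0 x y₀⟩
  -- Moving the constant `a` from `f` to `g` makes both nonnegative, since `-g y ≤ f x` everywhere.
  -- Truncation at 1 then keeps the constraint, because the indicator is at most 1.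
  set a := ⨅ x, f x
  have ha : ∀ x, 0 ≤ f x - a := fun x => sub_nonneg.2 (ciInf_le hbdd x)
  have ha' : ∀ y, 0 ≤ g y + a := fun y => by
    linarith [le_ciInf fun x => h0 x y]
  have hp : ((fun x => min (f x - a) 1, fun y => min (g y + a) 1) : (X → ℝ) × (Y → ℝ)) ∈
      unitDualPairs H := by
    refine ⟨(hf.1.sub_const a).min measurable_const, (hg.1.add_const a).min measurable_const,
      fun x => ⟨le_min (ha x) zero_le_one, min_le_right _ _⟩,
      fun y => ⟨le_min (ha' y) zero_le_one, min_le_right _ _⟩, fun x y => ?_⟩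
    have h1 := ind_le_one H (x, y)
    have h2 := hfg x y
    have h3 := ha x
    have h4 := ha' y
    rcases min_cases (f x - a) 1 with h | h <;> rcases min_cases (g y + a) 1 with h' | h' <;>
      simp only [h.1, h'.1] <;> linarith
  refine ⟨_, hp, ?_⟩
  have h1 : ∫ x, min (f x - a) 1 ∂μ ≤ ∫ x, f x ∂μ - a := by
    have := integral_mono (integrable_of_mem_Icc (μ := μ) hp.1 hp.2.2.1)
      (hf.2.sub (integrable_const a)) fun x => min_le_left _ _
    simpa [integral_sub hf.2 (integrable_const a)] using this
  have h2 : ∫ y, min (g y + a) 1 ∂ν ≤ ∫ y, g y ∂ν + a := by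
    have := integral_mono (integrable_of_mem_Icc (μ := ν) hp.2.1 hp.2.2.2.1)
      (hg.2.add (integrable_const a)) fun x => min_le_left _ _
    simpa [integral_add hg.2 (integrable_const a)] using this
  simp only [dualValue]
  linarith

/-! ### Continuity of the upper dual value along increasing sets -/

/-- Pointwise limits of dual pairs along an increasing sequence of sets. -/
theorem mem_unitDualPairs_iUnion_of_tendsto {H : ℕ → Set (X × Y)} (hH : Monotone H)
    {p : ℕ → (X → ℝ) × (Y → ℝ)} (hp : ∀ n, p n ∈ unitDualPairs (H n)) {f : X → ℝ} {g : Y → ℝ}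
    (hf : ∀ x, Tendsto (fun n => (p n).1 x) atTop (𝓝 (f x)))
    (hg : ∀ y, Tendsto (fun n => (p n).2 y) atTop (𝓝 (g y))) {b : ℝ}
    (hb : ∀ n, dualValue μ ν (p n) ≤ b) :
    (f, g) ∈ unitDualPairs (⋃ n, H n) ∧ dualValue μ ν (f, g) ≤ b := by
  refine ⟨⟨measurable_of_tendsto_metrizable (fun n => (hp n).1) (tendsto_pi_nhds.2 hf),
    measurable_of_tendsto_metrizable (fun n => (hp n).2.1) (tendsto_pi_nhds.2 hg),
    fun x => isClosed_Icc.mem_of_tendsto (hf x) (Eventually.of_forall fun n => (hp n).2.2.1 x),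
    fun y => isClosed_Icc.mem_of_tendsto (hg y) (Eventually.of_forall fun n => (hp n).2.2.2.1 y),
    fun x y => ?_⟩, ?_⟩
  · have hlim : Tendsto (fun n => (p n).1 x + (p n).2 y) atTop (𝓝 (f x + g y)) :=
      (hf x).add (hg y)
    by_cases h : (x, y) ∈ ⋃ n, H n
    · obtain ⟨m, hm⟩ := Set.mem_iUnion.1 h
      refine ge_of_tendsto hlim (eventually_atTop.2 ⟨m, fun n hn => ?_⟩)
      have := (hp n).2.2.2.2 x y
      rw [ind, Set.indicator_of_mem (hH hn hm)] at this
      rwa [ind, Set.indicator_of_mem h]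
    · rw [ind, Set.indicator_of_notMem h]
      exact ge_of_tendsto' hlim fun n => add_nonneg ((hp n).2.2.1 x).1 ((hp n).2.2.2.1 y).1
  · suffices Tendsto (fun n => dualValue μ ν (p n)) atTop (𝓝 (dualValue μ ν (f, g))) from
      le_of_tendsto' this hb
    refine Tendsto.add ?_ ?_
    · refine tendsto_integral_of_dominated_convergence (fun _ => 1)
        (fun n => (hp n).1.aestronglyMeasurable) (integrable_const 1)
        (fun n => Eventually.of_forall fun x => ?_) (Eventually.of_forall hf)
      rw [Real.norm_of_nonneg ((hp n).2.2.1 x).1]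
      exact ((hp n).2.2.1 x).2
    · refine tendsto_integral_of_dominated_convergence (fun _ => 1)
        (fun n => (hp n).2.1.aestronglyMeasurable) (integrable_const 1)
        (fun n => Eventually.of_forall fun y => ?_) (Eventually.of_forall hg)
      rw [Real.norm_of_nonneg ((hp n).2.2.2.1 y).1]
      exact ((hp n).2.2.2.1 y).2

theorem exists_tendsto_of_monotone {u : ℕ → ℝ} (hu : Monotone u)
    (h : ∀ n, u n ∈ Set.Icc (0 : ℝ) 1) : ∃ l, Tendsto u atTop (𝓝 l) :=
  ⟨_, tendsto_atTop_ciSup hu ⟨1, by rintro _ ⟨n, rfl⟩; exact (h n).2⟩⟩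

theorem exists_tendsto_of_antitone {u : ℕ → ℝ} (hu : Antitone u)
    (h : ∀ n, u n ∈ Set.Icc (0 : ℝ) 1) : ∃ l, Tendsto u atTop (𝓝 l) :=
  ⟨_, tendsto_atTop_ciInf hu ⟨0, by rintro _ ⟨n, rfl⟩; exact (h n).1⟩⟩

theorem supInfFrom_mem_unitDualPairs {H : ℕ → Set (X × Y)} (hH : Monotone H)
    {p : ℕ → (X → ℝ) × (Y → ℝ)} (hp : ∀ n, p n ∈ unitDualPairs (H n)) (d k : ℕ) :
    supInfFrom p d k ∈ unitDualPairs (H k) := by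
  induction d generalizing k with
  | zero => exact hp k
  | succ d ih =>
    exact supInf_mem_unitDualPairs (hp k) (unitDualPairs_anti (hH k.le_succ) (ih (k + 1)))

/-- The companion `infSup` pair is admissible for `H k`, so its value is at least `β*(H k)`. By
modularity, adjoining `p k` to the tail from `k + 1` therefore adds at most the defect `ε / 2 ^ (k +
1)` of `p k`, and the tail's own excess is at most the same amount. -/
theorem dualValue_supInfFrom_le {H : ℕ → Set (X × Y)} (hH : Monotone H)
    (hHm : ∀ n, MeasurableSet (H n)) {p : ℕ → (X → ℝ) × (Y → ℝ)}
    (hp : ∀ n, p n ∈ unitDualPairs (H n)) {b ε : ℝ} (hε : 0 ≤ ε)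
    (hb : ∀ n, betaStar μ ν (ind (H n)) ≤ b)
    (hpb : ∀ n, dualValue μ ν (p n) ≤ betaStar μ ν (ind (H n)) + ε / 2 ^ (n + 1)) (d k : ℕ) :
    dualValue μ ν (supInfFrom p d k) ≤ b + ε / 2 ^ k := by
  have hhalf : ∀ n : ℕ, ε / 2 ^ (n + 1) + ε / 2 ^ (n + 1) = ε / 2 ^ n := fun n => by
    field_simp; ring
  have hpos : ∀ n : ℕ, 0 ≤ ε / 2 ^ n := fun n => by positivity
  induction d generalizing k with
  | zero =>
    simp only [supInfFrom]
    linarith [hpb k, hb k, hhalf k, hpos (k + 1)]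
  | succ d ih =>
    have hmem := supInfFrom_mem_unitDualPairs hH hp d (k + 1)
    have h1 := dualValue_supInf_add_infSup μ ν (hp k) hmem
    have h2 := betaStar_le_dualValue μ ν (hHm k)
      (infSup_mem_unitDualPairs (hp k) (unitDualPairs_anti (hH k.le_succ) hmem))
    simp only [supInfFrom]
    linarith [hpb k, ih (k + 1), hhalf k]

/-- `β*` is continuous along increasing sequences of sets. -/
theorem betaStar_iUnion_le {H : ℕ → Set (X × Y)} (hH : Monotone H)
    (hHm : ∀ n, MeasurableSet (H n)) {b : ℝ} (hb : ∀ n, betaStar μ ν (ind (H n)) ≤ b) :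
    betaStar μ ν (ind (⋃ n, H n)) ≤ b := by
  refine le_of_forall_pos_le_add fun ε hε => ?_
  have hex : ∀ n, ∃ p ∈ unitDualPairs (H n),
      dualValue μ ν p ≤ betaStar μ ν (ind (H n)) + ε / 2 ^ (n + 1) := fun n => by
    obtain ⟨r, hr, hlt⟩ := exists_lt_of_csInf_lt
      (values_nonempty_bounded μ ν (ind_mem_admissibleCosts μ ν (hHm n))).2.2.2.2.2.1
      (show betaStar μ ν (ind (H n)) < betaStar μ ν (ind (H n)) + ε / 2 ^ (n + 1) from
        lt_add_of_pos_right _ (by positivity))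
    obtain ⟨p, hp, hle⟩ := exists_unitDualPair_le μ ν hr
    exact ⟨p, hp, hle.trans hlt.le⟩
  choose p hp hpb using hex
  have hmem := supInfFrom_mem_unitDualPairs hH hp
  have hval := dualValue_supInfFrom_le μ ν hH hHm hp hε.le hb hpb
  -- With `k` fixed, letting `d` grow gives the full tail supremum `F k` and infimum `G k`.
  have hF : ∀ k x, ∃ l, Tendsto (fun d => (supInfFrom p d k).1 x) atTop (𝓝 l) := fun k x =>
    exists_tendsto_of_monotone (monotone_nat_of_le_succ fun d => (supInfFrom_le_succ p d k).1 x)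
      fun d => (hmem d k).2.2.1 x
  have hG : ∀ k y, ∃ l, Tendsto (fun d => (supInfFrom p d k).2 y) atTop (𝓝 l) := fun k y =>
    exists_tendsto_of_antitone (antitone_nat_of_succ_le fun d => (supInfFrom_le_succ p d k).2 y)
      fun d => (hmem d k).2.2.2.1 y
  choose F hF using hF
  choose G hG using hG
  have hFG : ∀ k, (F k, G k) ∈ unitDualPairs (H k) ∧
      dualValue μ ν (F k, G k) ≤ b + ε / 2 ^ k := fun k => by
    have := mem_unitDualPairs_iUnion_of_tendsto μ ν (H := fun _ => H k) monotone_const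
      (fun d => hmem d k) (hF k) (hG k) (fun d => hval d k)
    rwa [Set.iUnion_const] at this
  -- Depth `d + 1` from `k` contains depth `d` from `k + 1`; the shift in `d` does not affect the
  -- limit.
  have hFa : ∀ x, Antitone fun k => F k x := fun x => antitone_nat_of_succ_le fun k =>
    le_of_tendsto_of_tendsto' (hF (k + 1) x) ((tendsto_add_atTop_iff_nat 1).2 (hF k x))
      fun d => (le_sup_right : _ ≤ (p k).1 ⊔ (supInfFrom p d (k + 1)).1) x
  have hGm : ∀ y, Monotone fun k => G k y := fun y => monotone_nat_of_le_succ fun k =>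
    le_of_tendsto_of_tendsto' ((tendsto_add_atTop_iff_nat 1).2 (hG k y)) (hG (k + 1) y)
      fun d => (inf_le_right : (p k).2 ⊓ (supInfFrom p d (k + 1)).2 ≤ _) y
  -- The limits in `k` are the limsup of the first components of `p` and the liminf of the second
  -- ones.
  choose f hf using fun x => exists_tendsto_of_antitone (hFa x) fun k => (hFG k).1.2.2.1 x
  choose g hg using fun y => exists_tendsto_of_monotone (hGm y) fun k => (hFG k).1.2.2.2.1 y
  obtain ⟨h1, h2⟩ := mem_unitDualPairs_iUnion_of_tendsto μ ν hH (fun k => (hFG k).1) hf hg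
    (b := b + ε) fun k => (hFG k).2.trans (by
      gcongr
      exact div_le_self hε.le (one_le_pow₀ one_le_two))
  exact (betaStar_le_dualValue μ ν (MeasurableSet.iUnion hHm) h1).trans h2

/-! ### Weak duality, monotonicity and complements -/

theorem integral_ind {P : Measure (X × Y)} {H : Set (X × Y)} (hH : MeasurableSet H) :
    ∫ z, ind H z ∂P = P.real H := integral_indicator_one hH

theorem betaStar_eq_alphaStar_of_le {H : Set (X × Y)} (hH : MeasurableSet H)
    (h : betaStar μ ν (ind H) ≤ alphaStar μ ν (ind H)) :
    alphaStar μ ν (ind H) = betaStar μ ν (ind H) := by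
  have hc := ind_mem_admissibleCosts μ ν hH
  obtain ⟨hne, -, -, -, -, hne', -⟩ := values_nonempty_bounded μ ν hc
  exact (csSup_le hne fun p hp => le_csInf hne' (dualValues_le hc hp).2).antisymm h

theorem alpha_eq_beta_of_le {H : Set (X × Y)} (hH : MeasurableSet H)
    (h : alpha μ ν (ind H) ≤ beta μ ν (ind H)) :
    alpha μ ν (ind H) = beta μ ν (ind H) := by
  have hc := ind_mem_admissibleCosts μ ν hH
  obtain ⟨hne, -, -, hne', -, -, -⟩ := values_nonempty_bounded μ ν hc
  exact h.antisymm (csSup_le hne' fun r hr => le_csInf hne fun p hp => (dualValues_le hc hp).1 r hr)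

theorem alphaStar_mono {H K : Set (X × Y)} (hH : MeasurableSet H) (hK : MeasurableSet K)
    (h : H ⊆ K) : alphaStar μ ν (ind H) ≤ alphaStar μ ν (ind K) := by
  have hcH := ind_mem_admissibleCosts μ ν hH
  have hcK := ind_mem_admissibleCosts μ ν hK
  refine csSup_le (values_nonempty_bounded μ ν hcH).1 ?_
  rintro _ ⟨P, hP, rfl⟩
  exact (integral_mono (integrable_of_mem_admissibleCosts hP hcH)
    (integrable_of_mem_admissibleCosts hP hcK) (ind_mono h)).trans
    (le_csSup (values_nonempty_bounded μ ν hcK).2.2.1 ⟨P, hP, rfl⟩)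

theorem beta_mono {H K : Set (X × Y)} (hH : MeasurableSet H) (hK : MeasurableSet K)
    (h : H ⊆ K) : beta μ ν (ind H) ≤ beta μ ν (ind K) := by
  have hcH := ind_mem_admissibleCosts μ ν hH
  have hcK := ind_mem_admissibleCosts μ ν hK
  refine csSup_le_csSup (values_nonempty_bounded μ ν hcK).2.2.2.2.1
    (values_nonempty_bounded μ ν hcH).2.2.2.1 ?_
  rintro _ ⟨f, hf, g, hg, hfg, rfl⟩
  exact ⟨f, hf, g, hg, fun x y => (hfg x y).trans (ind_mono h _), rfl⟩

/-- The two dualities are exchanged by complementation. -/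
theorem alpha_eq_beta_of_compl {K : Set (X × Y)} (hK : MeasurableSet K)
    (h : alphaStar μ ν (ind Kᶜ) = betaStar μ ν (ind Kᶜ)) :
    alpha μ ν (ind K) = beta μ ν (ind K) := by
  have hc := ind_mem_admissibleCosts μ ν hK
  have hc' := ind_mem_admissibleCosts μ ν hK.compl
  obtain ⟨-, hbb, -, -, hba, -, -⟩ := values_nonempty_bounded μ ν hc
  obtain ⟨hne, -, -, -, -, hne', -⟩ := values_nonempty_bounded μ ν hc'
  have h1 : alphaStar μ ν (ind Kᶜ) ≤ 1 - alpha μ ν (ind K) := by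
    refine csSup_le hne ?_
    rintro _ ⟨P, hP, rfl⟩
    have := hP.1
    have h2 : alpha μ ν (ind K) ≤ ∫ z, ind K z ∂P := csInf_le hbb ⟨P, hP, rfl⟩
    rw [integral_ind hK] at h2
    rw [integral_ind hK.compl, probReal_compl_eq_one_sub hK]
    linarith
  have h3 : 1 - beta μ ν (ind K) ≤ betaStar μ ν (ind Kᶜ) := by
    refine le_csInf hne' ?_
    rintro _ ⟨f, hf, g, hg, hfg, rfl⟩
    -- If `f + g` dominates the indicator of the complement, then `(1 - f, -g)` lies below that of
    -- `K`.
    have : 1 - ∫ x, f x ∂μ + -∫ y, g y ∂ν ≤ beta μ ν (ind K) := by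
      refine le_csSup hba ⟨fun x => 1 - f x, ⟨measurable_const.sub hf.1,
        (integrable_const 1).sub hf.2⟩, fun y => -g y, ⟨hg.1.neg, hg.2.neg⟩, fun x y => ?_, ?_⟩
      · have h4 := hfg x y
        have h5 : ind K (x, y) + ind Kᶜ (x, y) = 1 :=
          congrFun (Set.indicator_self_add_compl K fun _ => (1 : ℝ)) (x, y)
        linarith
      · rw [integral_sub (integrable_const 1) hf.2, integral_neg]
        simp
    linarith
  exact alpha_eq_beta_of_le μ ν hK (by linarith)

/-! ### Countable unions and intersections -/

theorem accumulate_mem_rectangleField {R : ℕ → Set (X × Y)}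
    (hR : ∀ n, R n ∈ rectangleField X Y) (n : ℕ) : Set.accumulate R n ∈ rectangleField X Y := by
  induction n with
  | zero => rw [Set.accumulate_zero_nat]; exact hR 0
  | succ n ih => rw [Set.accumulate_succ]; exact .union _ _ ih (hR _)

/-- The partial unions increase, stay in the field and have `β* = α*`, which is at most `α*` of the
whole union; continuity of `β*` carries this bound to the limit. -/
theorem alphaStar_eq_betaStar_iUnion {R : ℕ → Set (X × Y)}
    (hR : ∀ n, R n ∈ rectangleField X Y) :
    alphaStar μ ν (ind (⋃ n, R n)) = betaStar μ ν (ind (⋃ n, R n)) := by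
  have hS := accumulate_mem_rectangleField hR
  have hSm := fun n => measurableSet_of_mem_rectangleField (hS n)
  have hm : MeasurableSet (⋃ n, R n) :=
    MeasurableSet.iUnion fun n => measurableSet_of_mem_rectangleField (hR n)
  refine betaStar_eq_alphaStar_of_le μ ν hm ?_
  have := betaStar_iUnion_le μ ν Set.monotone_accumulate hSm
    (b := alphaStar μ ν (ind (⋃ n, R n))) fun n => by
      rw [← alphaStar_eq_betaStar_of_mem_rectangleField μ ν (hS n)]
      exact alphaStar_mono μ ν (hSm n) hm (Set.accumulate_subset_iUnion n)
  rwa [Set.iUnion_accumulate] at this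

theorem alpha_eq_beta_iInter {R : ℕ → Set (X × Y)} (hR : ∀ n, R n ∈ rectangleField X Y) :
    alpha μ ν (ind (⋂ n, R n)) = beta μ ν (ind (⋂ n, R n)) := by
  refine alpha_eq_beta_of_compl μ ν
    (MeasurableSet.iInter fun n => measurableSet_of_mem_rectangleField (hR n)) ?_
  rw [Set.compl_iInter]
  exact alphaStar_eq_betaStar_iUnion μ ν fun n => .compl _ (hR n)

theorem rectangle_mem_rectangleField {A : Set X} {B : Set Y} (hA : MeasurableSet A)
    (hB : MeasurableSet B) : A ×ˢ B ∈ rectangleField X Y :=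
  .base _ ⟨A, B, hA, hB, rfl⟩

/-! ### Inner approximation under the limsup condition -/

/-- Duality for `α` and `β` follows from approximation from inside by sets of the field,
uniformly over the couplings. -/
theorem alpha_eq_beta_of_approx {H : Set (X × Y)} (hH : MeasurableSet H) {S : ℕ → Set (X × Y)}
    (hS : ∀ n, S n ∈ rectangleField X Y) (hSH : ∀ n, S n ⊆ H) {e : ℕ → ℝ}
    (he : Tendsto e atTop (𝓝 0))
    (hle : ∀ n, ∀ P ∈ couplings μ ν, P.real H ≤ P.real (S n) + e n) :
    alpha μ ν (ind H) = beta μ ν (ind H) := by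
  refine alpha_eq_beta_of_le μ ν hH ?_
  have key : ∀ n, alpha μ ν (ind H) ≤ beta μ ν (ind H) + e n := by
    intro n
    have hSm := measurableSet_of_mem_rectangleField (hS n)
    have h1 : alpha μ ν (ind H) - e n ≤ alpha μ ν (ind (S n)) := by
      refine le_csInf (values_nonempty_bounded μ ν (ind_mem_admissibleCosts μ ν hSm)).1 ?_
      rintro _ ⟨P, hP, rfl⟩
      have : alpha μ ν (ind H) ≤ ∫ z, ind H z ∂P :=
        csInf_le (values_nonempty_bounded μ ν (ind_mem_admissibleCosts μ ν hH)).2.1 ⟨P, hP, rfl⟩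
      rw [integral_ind hH] at this
      rw [integral_ind hSm]
      linarith [hle n P hP]
    -- A single set of the field is the intersection of a constant sequence.
    have h2 := alpha_eq_beta_iInter μ ν (R := fun _ => S n) fun _ => hS n
    rw [Set.iInter_const] at h2
    linarith [beta_mono μ ν hSm hH (hSH n)]
  have := ge_of_tendsto' (he.const_add (beta μ ν (ind H))) key
  simpa using this

/-- Points missed by the first rectangles lie in the strip over the tail union of the `A j` (or of
the `B j`). Its mass is a marginal quantity, the same for every coupling, and tends to 0. -/
theorem alpha_eq_beta_iUnion_prod {A : ℕ → Set X} {B : ℕ → Set Y}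
    (hA : ∀ n, MeasurableSet (A n)) (hB : ∀ n, MeasurableSet (B n))
    (h : μ (⋂ n, ⋃ j > n, A j) = 0 ∨ ν (⋂ n, ⋃ j > n, B j) = 0) :
    alpha μ ν (ind (⋃ n, A n ×ˢ B n)) = beta μ ν (ind (⋃ n, A n ×ˢ B n)) := by
  have hR := fun n => rectangle_mem_rectangleField (hA n) (hB n)
  have hm : MeasurableSet (⋃ n, A n ×ˢ B n) := MeasurableSet.iUnion fun n => (hA n).prod (hB n)
  have hS := accumulate_mem_rectangleField hR
  have hsplit : ∀ n z, z ∈ ⋃ n, A n ×ˢ B n →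
      z ∈ Set.accumulate (fun n => A n ×ˢ B n) n ∨ ∃ j > n, z ∈ A j ×ˢ B j := by
    intro n z hz
    obtain ⟨j, hj⟩ := Set.mem_iUnion.1 hz
    rcases le_or_gt j n with hjn | hjn
    · exact .inl (Set.mem_accumulate.2 ⟨j, hjn, hj⟩)
    · exact .inr ⟨j, hjn, hj⟩
  rcases h with h | h
  · refine alpha_eq_beta_of_approx μ ν hm hS (fun n => Set.accumulate_subset_iUnion n)
      (tendsto_measureReal_iUnion_gt μ hA h) fun n P hP => ?_
    obtain ⟨hp, rfl, -⟩ := hP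
    have hU : MeasurableSet (⋃ j > n, A j) :=
      MeasurableSet.biUnion (Set.to_countable {j | j > n}) fun j _ => hA j
    rw [Measure.fst, map_measureReal_apply measurable_fst hU]
    refine (measureReal_mono fun z hz => ?_).trans (measureReal_union_le _ _)
    refine (hsplit n z hz).imp_right ?_
    rintro ⟨j, hj, hz⟩
    exact Set.mem_biUnion hj hz.1
  · refine alpha_eq_beta_of_approx μ ν hm hS (fun n => Set.accumulate_subset_iUnion n)
      (tendsto_measureReal_iUnion_gt ν hB h) fun n P hP => ?_
    obtain ⟨hp, -, rfl⟩ := hP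
    have hU : MeasurableSet (⋃ j > n, B j) :=
      MeasurableSet.biUnion (Set.to_countable {j | j > n}) fun j _ => hB j
    rw [Measure.snd, map_measureReal_apply measurable_snd hU]
    refine (measureReal_mono fun z hz => ?_).trans (measureReal_union_le _ _)
    refine (hsplit n z hz).imp_right ?_
    rintro ⟨j, hj, hz⟩
    exact Set.mem_biUnion hj hz.2

end TransportDuality

theorem theorem3p2 {X Y : Type*} [MeasurableSpace X] [MeasurableSpace Y]
    (μ : Measure X) (ν : Measure Y) [IsProbabilityMeasure μ] [IsProbabilityMeasure ν] :
    -- duality for countable unions and countable intersections of elements of the field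
    (∀ R : ℕ → Set (X × Y), (∀ n, R n ∈ TransportDuality.rectangleField X Y) →
      TransportDuality.alphaStar μ ν (TransportDuality.ind (⋃ n, R n)) =
          TransportDuality.betaStar μ ν (TransportDuality.ind (⋃ n, R n)) ∧
        TransportDuality.alpha μ ν (TransportDuality.ind (⋂ n, R n)) =
          TransportDuality.beta μ ν (TransportDuality.ind (⋂ n, R n))) ∧
    -- the other duality for countable unions of rectangles, under the limsup condition
    (∀ (A : ℕ → Set X) (B : ℕ → Set Y),
      (∀ n, MeasurableSet (A n)) → (∀ n, MeasurableSet (B n)) →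
      (μ (⋂ n, ⋃ j > n, A j) = 0 ∨ ν (⋂ n, ⋃ j > n, B j) = 0) →
      TransportDuality.alpha μ ν (TransportDuality.ind (⋃ n, A n ×ˢ B n)) =
        TransportDuality.beta μ ν (TransportDuality.ind (⋃ n, A n ×ˢ B n))) ∧
    -- positive answer to Arveson's problem for countable unions of rectangles
    (∀ (A : ℕ → Set X) (B : ℕ → Set Y),
      (∀ n, MeasurableSet (A n)) → (∀ n, MeasurableSet (B n)) →
      (∀ P ∈ TransportDuality.couplings μ ν, P (⋃ n, A n ×ˢ B n) = 0) →
      ∃ (A₀ : Set X) (B₀ : Set Y), MeasurableSet A₀ ∧ MeasurableSet B₀ ∧ μ A₀ = 0 ∧ ν B₀ = 0 ∧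
        (⋃ n, A n ×ˢ B n) ⊆ (A₀ ×ˢ Set.univ) ∪ (Set.univ ×ˢ B₀)) :=
  ⟨fun _ hR => ⟨TransportDuality.alphaStar_eq_betaStar_iUnion μ ν hR,
      TransportDuality.alpha_eq_beta_iInter μ ν hR⟩,
    fun _ _ hA hB h => TransportDuality.alpha_eq_beta_iUnion_prod μ ν hA hB h,
    fun _ _ hA hB h => TransportDuality.exists_null_strips_of_prod_eq_zero μ ν hA hB
      (h _ ⟨inferInstance, by simp, by simp⟩)⟩
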